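/- Let $n\ge 1$ be an integer and let $\sigma=\sigma_1\sigma_2\cdots\sigma_n$ range over the permutations of $\{1,\dots,n\}$ (permutations of size $n$). An index $1\le i<n$ is an ascent of $\sigma$ if $\sigma_i<\sigma_{i+1}$ and a descent if $\sigma_i>\sigma_{i+1}$. Say that $\sigma$ has a positive up-down sequence if for all $j\le n$ the number of ascents less than $j$ is no more than the number of descents less than $j$. Say that $\sigma$ has a Dyck up-down sequence if it has exactly one more ascent than descents, but for all $j<n$ the number of ascents less than $j$ is no more than the number of descents less than $j$. Let $m!!=m(m-2)(m-4)\cdots$, the product running over the positive terms, with $0!!=(-1)!!=1$. Theorem. The number of permutations of size $n$ having a positive up-down sequence is $[(n-1)!!]^2$ if $n$ is even and $n!!\,(n-2)!!$ if $n$ is odd. The number of permutations of size $n$ having a Dyck up-down sequence is $(n-1)!!\,(n-3)!!$ if $n$ is even and $0$ if $n$ is odd. -/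

import Mathlib

open scoped Nat

namespace UpDown

/-- `i` is an ascent of `σ = σ₁ … σₙ`: an index `1 ≤ i < n` with `σᵢ < σᵢ₊₁`.
The entry `σᵢ` (with `i` counted from `1`) is the value of `σ` at the element `i - 1` of `Fin n`. -/
def IsAscent {n : ℕ} (σ : Equiv.Perm (Fin n)) (i : ℕ) : Prop :=
  ∃ h : 1 ≤ i ∧ i < n, σ ⟨i - 1, (Nat.sub_le i 1).trans_lt h.2⟩ < σ ⟨i, h.2⟩

/-- `i` is a descent of `σ = σ₁ … σₙ`: an index `1 ≤ i < n` with `σᵢ > σᵢ₊₁`. -/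
def IsDescent {n : ℕ} (σ : Equiv.Perm (Fin n)) (i : ℕ) : Prop :=
  ∃ h : 1 ≤ i ∧ i < n, σ ⟨i - 1, (Nat.sub_le i 1).trans_lt h.2⟩ > σ ⟨i, h.2⟩

instance {n : ℕ} (σ : Equiv.Perm (Fin n)) : DecidablePred (IsAscent σ) := fun i => by
  unfold IsAscent; infer_instance

instance {n : ℕ} (σ : Equiv.Perm (Fin n)) : DecidablePred (IsDescent σ) := fun i => by
  unfold IsDescent; infer_instance

/-- The number of ascents of `σ` that are less than `j`. -/
def ascentsBelow {n : ℕ} (σ : Equiv.Perm (Fin n)) (j : ℕ) : ℕ :=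
  ((Finset.range j).filter (IsAscent σ)).card

/-- The number of descents of `σ` that are less than `j`. -/
def descentsBelow {n : ℕ} (σ : Equiv.Perm (Fin n)) (j : ℕ) : ℕ :=
  ((Finset.range j).filter (IsDescent σ)).card

/-- `σ` has a positive up-down sequence: for all `j ≤ n`, the number of ascents less than `j`
is no more than the number of descents less than `j`. -/
def HasPositiveUpDown {n : ℕ} (σ : Equiv.Perm (Fin n)) : Prop :=
  ∀ j ≤ n, ascentsBelow σ j ≤ descentsBelow σ j

/-- `σ` has a Dyck up-down sequence: it has one more ascent than descents, but for all `j < n`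
the number of ascents less than `j` is no more than the number of descents less than `j`.
All ascents and descents of `σ` are less than `n`. -/
def HasDyckUpDown {n : ℕ} (σ : Equiv.Perm (Fin n)) : Prop :=
  ascentsBelow σ n = descentsBelow σ n + 1 ∧
    ∀ j < n, ascentsBelow σ j ≤ descentsBelow σ j

end UpDown

/-! Read a permutation as a path, up at each descent and down at each ascent; positive means never
below the start. Cut a word of length `n ≥ 1` in two, discarding the step across the cut, so that
the left path ends at its minimum and the right one starts at its minimum. Exactly two cuts work:
just before the first global minimum and just after the last (`card_splits_eq_two`). Reversal turns
left parts into positive words, so the numbers `b n` of positive words satisfy `∑ k, n.choose k * b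
k * b (n - k) = 2 * n!` (`positiveCount_convolution`). Their exponential generating function thus
has `B² = (1 + X) / (1 - X)`, hence `(1 - X²) B' = B`, a recurrence solved by double factorials.

For Dyck sequences, drop the last letter: a positive word of size `n` remains, and conversely each
extension of one is either positive or Dyck (`positiveCount_add_dyckCount`). -/

namespace UpDown

/-! ### Cutting a path at its minima -/

/-- A path with unit steps has exactly two splitting points between a part that ends at its minimum
and a part that starts at its minimum. -/
theorem card_splits_eq_two {n : ℕ} (hn : 1 ≤ n) (h : ℕ → ℤ)
    (step : ∀ i, i + 1 < n → h (i + 1) = h i + 1 ∨ h (i + 1) = h i - 1) :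
    ((Finset.range (n + 1)).filter fun k =>
      (∀ i < k, h (k - 1) ≤ h i) ∧ ∀ i, k ≤ i → i < n → h k ≤ h i).card = 2 := by
  obtain ⟨a, ha, hmin⟩ := Finset.exists_min_image (Finset.range n) h ⟨0, Finset.mem_range.2 hn⟩
  simp only [Finset.mem_range] at ha hmin
  set S := (Finset.range n).filter fun i => h i = h a with hS
  have hne : S.Nonempty := ⟨a, by simp [hS, ha]⟩
  have hp := S.min'_mem hne
  have hq := S.max'_mem hne
  have hpl : ∀ i < n, h i = h a → S.min' hne ≤ i := fun i hi e => S.min'_le i (by simp [hS, hi, e])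
  have hql : ∀ i < n, h i = h a → i ≤ S.max' hne := fun i hi e => S.le_max' i (by simp [hS, hi, e])
  have hpq := hpl _ (by simp only [hS, Finset.mem_filter, Finset.mem_range] at hq; exact hq.1)
    (by simp only [hS, Finset.mem_filter, Finset.mem_range] at hq; exact hq.2)
  generalize S.min' hne = p at *
  generalize S.max' hne = q at *
  simp only [hS, Finset.mem_filter, Finset.mem_range] at hp hq
  -- `p` and `q` are the first and last minimisers; `p ≤ q`, so the two cuts differ.
  have key : ((Finset.range (n + 1)).filter fun k =>
      (∀ i < k, h (k - 1) ≤ h i) ∧ ∀ i, k ≤ i → i < n → h k ≤ h i) = {p, q + 1} := by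
    ext k
    simp only [Finset.mem_filter, Finset.mem_range, Finset.mem_insert, Finset.mem_singleton]
    constructor
    · rintro ⟨hk, h1, h2⟩
      rcases Nat.eq_zero_or_pos k with rfl | hk0
      · left
        have := h2 a (Nat.zero_le _) ha
        have := hmin 0 hn
        have := hpl 0 hn (by omega)
        omega
      obtain ⟨j, rfl⟩ : ∃ j, k = j + 1 := ⟨k - 1, by omega⟩
      simp only [Nat.add_sub_cancel] at h1
      rcases Nat.lt_or_ge (j + 1) n with hjn | hjn
      -- If the discarded step goes up, the left part holds every global minimum and ends at one, so
      -- `j = q`; if it goes down, the right part starts at the first one.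
      · rcases step j hjn with e | e
        · right
          by_cases haj : a < j + 1
          · have e1 : h j = h a := le_antisymm (h1 a haj) (hmin j (by omega))
            have e2 := hql j (by omega) e1
            by_contra hne
            have := h2 q (by omega) hq.1
            omega
          · have := h2 a (by omega) ha
            have := hmin j (by omega)
            omega
        · left
          by_cases haj : a < j + 1
          · have := h1 a haj
            have := hmin (j + 1) hjn
            omega
          · have e1 : h (j + 1) = h a := le_antisymm (h2 a (by omega) ha) (hmin _ hjn)
            have e2 := hpl _ hjn e1
            by_contra hne
            have := h1 p (by omega)
            omega
      · right
        have := h1 a (by omega)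
        have := hmin j (by omega)
        have := hql j (by omega) (by omega)
        omega
    · rintro (rfl | rfl)
      · refine ⟨by omega, fun i hi => ?_, fun i _ hi => hp.2 ▸ hmin i hi⟩
        obtain ⟨j, rfl⟩ : ∃ j, k = j + 1 := ⟨k - 1, by omega⟩
        have h3 := hmin i (by omega)
        have h4 : h i ≠ h a := fun e => by have := hpl i (by omega) e; omega
        simp only [Nat.add_sub_cancel]
        have := step j hp.1
        omega
      · refine ⟨by omega, fun i hi => ?_, fun i hi hin => ?_⟩
        · simp only [Nat.add_sub_cancel]
          exact hq.2 ▸ hmin i (by omega)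
        · have h3 := hmin i (by omega)
          have h4 : h i ≠ h a := fun e => by have := hql i (by omega) e; omega
          have := step q (by omega)
          omega
  rw [key, Finset.card_pair (by omega)]

/-! ### Generating function and recurrence -/

section PowerSeries
open PowerSeries

theorem recurrence_of_convolution (b : ℕ → ℕ) (h0 : b 0 = 1)
    (hb : ∀ n, 1 ≤ n → ∑ k ∈ Finset.range (n + 1), n.choose k * (b k * b (n - k)) = 2 * n !) (n : ℕ) :
    b (n + 2) = b (n + 1) + (n + 1) * n * b n := by
  set B : ℚ⟦X⟧ := PowerSeries.mk fun n => (b n : ℚ) / n ! with hB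
  have hsq : ∀ n, 1 ≤ n → coeff n (B * B) = 2 := by
    intro n hn
    rw [coeff_mul, Finset.Nat.sum_antidiagonal_eq_sum_range_succ_mk]
    have hf : (n ! : ℚ) ≠ 0 := by positivity
    rw [← mul_right_inj' hf, mul_comm _ (2 : ℚ)]
    have := congrArg (Nat.cast : ℕ → ℚ) (hb n hn)
    push_cast at this
    rw [← this, Finset.mul_sum]
    refine Finset.sum_congr rfl fun k hk => ?_
    rw [Nat.cast_choose ℚ (Nat.lt_succ_iff.1 (Finset.mem_range.1 hk))]
    simp only [hB, coeff_mk]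
    have h1 : (k ! : ℚ) ≠ 0 := by positivity
    have h2 : ((n - k)! : ℚ) ≠ 0 := by positivity
    field_simp
  have hz : coeff 0 (B * B) = 1 := by
    simp [hB, h0]
  have hfun : B * B = 1 + X + X * (B * B) := by
    ext n
    rcases n with _ | _ | n
    · simp [coeff_zero_X_mul, hz, -coeff_zero_eq_constantCoeff, coeff_zero_X]
    · rw [map_add, map_add, coeff_succ_X_mul, hz, hsq _ le_rfl]
      norm_num [coeff_one, coeff_X]
    · rw [map_add, map_add, coeff_succ_X_mul, hsq _ (by omega), hsq _ (by omega)]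
      simp [coeff_one, coeff_X]
  have hder := congrArg (derivative ℚ) hfun
  simp only [map_add, Derivation.leibniz, smul_eq_mul, derivative_X, Derivation.map_one_eq_zero] at hder
  have hB0 : B ≠ 0 := fun e => by simp [e] at hz
  have hode : derivative ℚ B = X ^ 2 * derivative ℚ B + B := by
    have h2 : (2 : ℚ⟦X⟧) * B ≠ 0 := mul_ne_zero (fun e => by
      have := congrArg constantCoeff e
      rw [map_ofNat, map_zero] at this
      norm_num at this) hB0
    apply mul_left_cancel₀ h2
    -- `hder` gives `2(1 - X)BB' = 1 + B²`; times `1 + X`, with `1 + X = (1 - X)B²`, the right side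
    -- becomes `2B²`.
    linear_combination (1 + X) * hder - hfun
  have hc := congrArg (coeff (n + 1)) hode
  rw [map_add, coeff_derivative] at hc
  have hx : coeff (n + 1) (X ^ 2 * derivative ℚ B) = n * coeff n B := by
    rcases n with _ | n
    · simp [coeff_X_pow_mul']
    · rw [show n + 1 + 1 = n + 2 from rfl, coeff_X_pow_mul, coeff_derivative]
      push_cast; ring
  rw [hx] at hc
  simp only [hB, coeff_mk, Nat.factorial_succ] at hc
  have h1 : (n ! : ℚ) ≠ 0 := by positivity
  push_cast at hc
  field_simp at hc
  have : (b (n + 2) : ℚ) = b (n + 1) + (n + 1) * n * b n := by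
    have h2 : (n : ℚ) + 1 ≠ 0 := by positivity
    have h3 : (n : ℚ) + 1 + 1 ≠ 0 := by positivity
    linear_combination hc
  exact_mod_cast this

end PowerSeries

theorem eq_doubleFactorial_of_recurrence (b : ℕ → ℕ) (h0 : b 0 = 1) (h1 : b 1 = 1)
    (hb : ∀ n, b (n + 2) = b (n + 1) + (n + 1) * n * b n) (m : ℕ) :
    b (2 * m) = (2 * m - 1)‼ ^ 2 ∧ b (2 * m + 1) = (2 * m + 1)‼ * (2 * m - 1)‼ := by
  induction m with
  | zero => simp [h0, h1]
  | succ m ih =>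
    have e : b (2 * (m + 1)) = (2 * (m + 1) - 1)‼ ^ 2 := by
      rw [show 2 * (m + 1) = 2 * m + 2 by ring, hb, ih.1, ih.2]
      rcases m with _ | m
      · simp
      · rw [show 2 * (m + 1) + 2 - 1 = 2 * m + 1 + 2 by omega,
          show 2 * (m + 1) + 1 = 2 * m + 1 + 2 by omega, show 2 * (m + 1) - 1 = 2 * m + 1 by omega,
          Nat.doubleFactorial_add_two]
        ring
    refine ⟨e, ?_⟩
    rw [show 2 * (m + 1) + 1 = 2 * m + 1 + 2 by ring, hb, show 2 * m + 1 + 1 = 2 * (m + 1) by ring, e,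
      ih.2, show 2 * (m + 1) - 1 = 2 * m + 1 by omega, Nat.doubleFactorial_add_two]
    rcases m with _ | m
    · simp
    · rw [show 2 * (m + 1) + 1 = 2 * m + 1 + 2 by omega, show 2 * (m + 1) - 1 = 2 * m + 1 by omega,
          Nat.doubleFactorial_add_two]
      ring

/-! ### Words on a finite alphabet -/

/-- The words in which every element of `S` occurs exactly once and no other letter occurs. -/
def words (S : Finset ℕ) : Finset (List ℕ) := ⟨S.val.lists, Multiset.lists_nodup_finset S⟩

theorem mem_words {S : Finset ℕ} {l : List ℕ} : l ∈ words S ↔ l.Nodup ∧ l.toFinset = S := by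
  change l ∈ S.val.lists ↔ _
  rw [Multiset.mem_lists_iff]
  constructor
  · intro h
    have hn : l.Nodup := by
      have := S.nodup
      rw [h] at this
      simpa using this
    exact ⟨hn, Finset.val_injective (by rw [h, List.toFinset_val, hn.dedup]; rfl)⟩
  · rintro ⟨hn, rfl⟩
    rw [List.toFinset_val, hn.dedup]; rfl

theorem length_of_mem_words {S : Finset ℕ} {l : List ℕ} (h : l ∈ words S) : l.length = S.card := by
  obtain ⟨hn, rfl⟩ := mem_words.1 h
  exact (List.toFinset_card_of_nodup hn).symm

theorem card_words (S : Finset ℕ) : (words S).card = S.card ! := by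
  change S.val.lists.card = _
  rw [← Finset.coe_toList S, Multiset.lists_coe]
  simp [List.length_permutations]

/-- Once the set `T` of the first `k` letters is chosen, the two halves are independent words on `T`
and `S \ T`. -/
theorem card_words_split (S : Finset ℕ) {k : ℕ} (hk : k ≤ S.card) (P Q : List ℕ → Prop)
    [DecidablePred P] [DecidablePred Q] :
    ((words S).filter fun l => P (l.take k) ∧ Q (l.drop k)).card =
      ∑ T ∈ S.powersetCard k, ((words T).filter P).card * ((words (S \ T)).filter Q).card := by
  simp_rw [← Finset.card_product]
  rw [← Finset.card_sigma]
  refine Finset.card_nbij' (fun l => ⟨(l.take k).toFinset, (l.take k, l.drop k)⟩)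
    (fun x => x.2.1 ++ x.2.2) ?_ ?_ ?_ ?_
  · intro l hl
    simp only [Finset.coe_filter, Set.mem_ofPred_eq, mem_words] at hl
    obtain ⟨⟨hn, rfl⟩, hP, hQ⟩ := hl
    have hn' : (l.take k ++ l.drop k).Nodup := by rwa [List.take_append_drop]
    rw [List.nodup_append] at hn'
    have hS : l.toFinset = (l.take k).toFinset ∪ (l.drop k).toFinset := by
      rw [← List.toFinset_append, List.take_append_drop]
    rw [List.toFinset_card_of_nodup hn] at hk
    simp only [Finset.coe_sigma, Set.mem_sigma_iff, Finset.mem_coe, Finset.mem_powersetCard,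
      Finset.mem_product, Finset.mem_filter, mem_words]
    refine ⟨⟨by rw [hS]; exact Finset.subset_union_left, ?_⟩, ⟨⟨hn'.1, trivial⟩, hP⟩, ⟨hn'.2.1, ?_⟩, hQ⟩
    · rw [List.toFinset_card_of_nodup hn'.1, List.length_take, min_eq_left hk]
    · rw [hS, Finset.union_sdiff_cancel_left]
      rw [Finset.disjoint_left]
      intro a ha hb
      exact hn'.2.2 a (List.mem_toFinset.1 ha) a (List.mem_toFinset.1 hb) rfl
  · rintro ⟨T, a, b⟩ hx
    simp only [Finset.coe_sigma, Set.mem_sigma_iff, Finset.mem_coe, Finset.mem_powersetCard,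
      Finset.mem_product, Finset.mem_filter] at hx
    obtain ⟨⟨hT, rfl⟩, ⟨ha, hP⟩, hb, hQ⟩ := hx
    have hl := length_of_mem_words ha
    simp only [mem_words] at ha hb
    simp only [Finset.coe_filter, Set.mem_ofPred_eq, mem_words]
    rw [List.take_left' hl, List.drop_left' hl, List.nodup_append, List.toFinset_append, ha.2, hb.2,
      Finset.union_sdiff_of_subset hT]
    refine ⟨⟨⟨ha.1, hb.1, fun x hx y hy e => ?_⟩, rfl⟩, hP, hQ⟩
    subst e
    rw [← List.mem_toFinset, ha.2] at hx
    rw [← List.mem_toFinset, hb.2] at hy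
    exact (Finset.mem_sdiff.1 hy).2 hx
  · intro l _
    exact List.take_append_drop k l
  · rintro ⟨T, a, b⟩ hx
    simp only [Finset.coe_sigma, Set.mem_sigma_iff, Finset.mem_coe, Finset.mem_powersetCard,
      Finset.mem_product, Finset.mem_filter] at hx
    obtain ⟨⟨hT, rfl⟩, ⟨ha, hP⟩, hb, hQ⟩ := hx
    have hl := length_of_mem_words ha
    simp only [List.take_left' hl, List.drop_left' hl, (mem_words.1 ha).2]

/-! ### Height of a word -/

/-- The number of descents minus the number of ascents among the first `i` steps of `l`. -/
def height (l : List ℕ) (i : ℕ) : ℤ :=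
  ∑ j ∈ Finset.range i, if l.getD (j + 1) 0 < l.getD j 0 then 1 else -1

theorem height_zero (l : List ℕ) : height l 0 = 0 := rfl

theorem height_succ (l : List ℕ) (i : ℕ) :
    height l (i + 1) = height l i + if l.getD (i + 1) 0 < l.getD i 0 then 1 else -1 :=
  Finset.sum_range_succ _ _

/-- Strictness matters: `height _ i` reads the letter at index `i`, which at `i = k` would be the
default `0` in the truncated word. -/
theorem height_take (l : List ℕ) {k i : ℕ} (hi : i < k) : height (l.take k) i = height l i := by
  refine Finset.sum_congr rfl fun j hj => ?_
  have := Finset.mem_range.1 hj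
  simp [List.getD_eq_getElem?_getD, show j < k by omega,
    show j + 1 < k by omega]

theorem height_drop (l : List ℕ) (k i : ℕ) :
    height (l.drop k) i = height l (k + i) - height l k := by
  induction i with
  | zero => simp [height_zero]
  | succ i ih =>
    rw [height_succ, ← add_assoc, height_succ, ih]
    simp only [List.getD_eq_getElem?_getD, List.getElem?_drop, add_assoc]
    ring

/-- The same path is traced backwards, shifted to start at `0`. Distinct letters are needed because
a tie would count `-1` in both directions. -/
theorem height_reverse {l : List ℕ} (hn : l.Nodup) {i : ℕ} (hi : i < l.length) :
    height l.reverse i = height l (l.length - 1 - i) - height l (l.length - 1) := by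
  induction i with
  | zero => simp [height_zero]
  | succ i ih =>
    rw [height_succ, ih (by omega), List.getD_reverse _ hi, List.getD_reverse _ (by omega)]
    obtain ⟨m, hm⟩ : ∃ m, l.length = i + m + 2 := ⟨l.length - i - 2, by omega⟩
    rw [show l.length - 1 - i = m + 1 by omega, show l.length - 1 - (i + 1) = m by omega, height_succ]
    have hne : l.getD m 0 ≠ l.getD (m + 1) 0 := by
      rw [List.getD_eq_getElem _ _ (by omega), List.getD_eq_getElem _ _ (by omega)]
      intro e
      have := (hn.getElem_inj_iff).1 e
      omega
    split_ifs <;> omega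

/-- The path of `l` never goes below its starting point. -/
def StartsAtMin (l : List ℕ) : Prop := ∀ i < l.length, 0 ≤ height l i

/-- The path of `l` never goes below its end point. -/
def EndsAtMin (l : List ℕ) : Prop := ∀ i < l.length, height l (l.length - 1) ≤ height l i

theorem startsAtMin_reverse {l : List ℕ} (hn : l.Nodup) : StartsAtMin l.reverse ↔ EndsAtMin l := by
  simp only [StartsAtMin, EndsAtMin, List.length_reverse]
  constructor
  · intro h i hi
    have := h (l.length - 1 - i) (by omega)
    rw [height_reverse hn (by omega), show l.length - 1 - (l.length - 1 - i) = i by omega] at this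
    linarith
  · intro h i hi
    rw [height_reverse hn hi]
    linarith [h (l.length - 1 - i) (by omega)]

theorem startsAtMin_take {l : List ℕ} {k : ℕ} (hk : k ≤ l.length) :
    StartsAtMin (l.take k) ↔ ∀ i < k, 0 ≤ height l i := by
  simp only [StartsAtMin, List.length_take, min_eq_left hk]
  exact forall₂_congr fun i hi => by rw [height_take l hi]

theorem endsAtMin_take {l : List ℕ} {k : ℕ} (hk : k ≤ l.length) :
    EndsAtMin (l.take k) ↔ ∀ i < k, height l (k - 1) ≤ height l i := by
  simp only [EndsAtMin, List.length_take, min_eq_left hk]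
  exact forall₂_congr fun i hi => by rw [height_take l hi, height_take l (by omega)]

theorem startsAtMin_drop {l : List ℕ} {k : ℕ} :
    StartsAtMin (l.drop k) ↔ ∀ i, k ≤ i → i < l.length → height l k ≤ height l i := by
  simp only [StartsAtMin, List.length_drop, height_drop, sub_nonneg]
  constructor
  · intro h i hi hl
    have := h (i - k) (by omega)
    rwa [Nat.add_sub_cancel' hi] at this
  · intro h i hi
    exact h _ (by omega) (by omega)

/-! ### From permutations to words -/

/-- The one-line notation of `σ`, its values transported to `S` by the increasing bijection. -/
def wordOf (S : Finset ℕ) {n : ℕ} (hS : S.card = n) (σ : Equiv.Perm (Fin n)) : List ℕ :=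
  List.ofFn fun i => S.orderEmbOfFin hS (σ i)

theorem length_wordOf {S : Finset ℕ} {n : ℕ} (hS : S.card = n) (σ : Equiv.Perm (Fin n)) :
    (wordOf S hS σ).length = n := by
  simp [wordOf]

theorem wordOf_injective {S : Finset ℕ} {n : ℕ} (hS : S.card = n) :
    Function.Injective (wordOf S hS) := by
  intro σ τ h
  ext1 i
  exact (S.orderEmbOfFin hS).injective (congrFun (List.ofFn_injective h) i)

theorem image_wordOf {S : Finset ℕ} {n : ℕ} (hS : S.card = n) :
    Finset.univ.image (wordOf S hS) = words S := by
  refine Finset.eq_of_subset_of_card_le (fun l hl => ?_) ?_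
  · obtain ⟨σ, -, rfl⟩ := Finset.mem_image.1 hl
    have hn : (wordOf S hS σ).Nodup :=
      List.nodup_ofFn.2 ((S.orderEmbOfFin hS).injective.comp σ.injective)
    rw [mem_words]
    refine ⟨hn, ?_⟩
    refine Finset.eq_of_subset_of_card_le (fun x hx => ?_) ?_
    · rw [List.mem_toFinset, wordOf, List.mem_ofFn] at hx
      obtain ⟨i, rfl⟩ := hx
      exact S.orderEmbOfFin_mem hS _
    · rw [List.toFinset_card_of_nodup hn, length_wordOf, hS]
  · rw [card_words, Finset.card_image_of_injective _ (wordOf_injective hS), Finset.card_univ,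
      Fintype.card_perm, Fintype.card_fin, hS]

theorem card_filter_words {S : Finset ℕ} {n : ℕ} (hS : S.card = n) (P : List ℕ → Prop)
    [DecidablePred P] :
    ((words S).filter P).card = Nat.card {σ : Equiv.Perm (Fin n) // P (wordOf S hS σ)} := by
  rw [← image_wordOf hS, Finset.filter_image, Finset.card_image_of_injective _ (wordOf_injective hS),
    Nat.card_eq_fintype_card, Fintype.card_subtype]

theorem ascentsBelow_succ {n : ℕ} (σ : Equiv.Perm (Fin n)) (j : ℕ) :
    ascentsBelow σ (j + 1) = ascentsBelow σ j + if IsAscent σ j then 1 else 0 := by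
  rw [ascentsBelow, Finset.card_filter, Finset.sum_range_succ, ← Finset.card_filter, ascentsBelow]

theorem descentsBelow_succ {n : ℕ} (σ : Equiv.Perm (Fin n)) (j : ℕ) :
    descentsBelow σ (j + 1) = descentsBelow σ j + if IsDescent σ j then 1 else 0 := by
  rw [descentsBelow, Finset.card_filter, Finset.sum_range_succ, ← Finset.card_filter, descentsBelow]

/-- The shift to `i + 1` comes from numbering steps from `0` in `height` but from `1` for ascents
and descents. -/
theorem height_wordOf {S : Finset ℕ} {n : ℕ} (hS : S.card = n) (σ : Equiv.Perm (Fin n)) {i : ℕ}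
    (hi : i < n) :
    height (wordOf S hS σ) i = descentsBelow σ (i + 1) - ascentsBelow σ (i + 1) := by
  induction i with
  | zero =>
    rw [descentsBelow_succ, ascentsBelow_succ, if_neg (fun h => absurd h.1.1 (by omega)),
      if_neg (fun h => absurd h.1.1 (by omega))]
    simp [height_zero, descentsBelow, ascentsBelow]
  | succ i ih =>
    rw [height_succ, ih (by omega), descentsBelow_succ σ (i + 1), ascentsBelow_succ σ (i + 1)]
    have hlt : (wordOf S hS σ).getD (i + 1) 0 < (wordOf S hS σ).getD i 0 ↔
        σ ⟨i + 1, hi⟩ < σ ⟨i, by omega⟩ := by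
      rw [List.getD_eq_getElem _ _ (by rw [length_wordOf]; omega),
        List.getD_eq_getElem _ _ (by rw [length_wordOf]; omega)]
      simp [wordOf]
    have hne : σ ⟨i + 1, hi⟩ ≠ σ ⟨i, by omega⟩ := fun e => by
      simpa using congrArg Fin.val (σ.injective e)
    have hD : IsDescent σ (i + 1) ↔ σ ⟨i + 1, hi⟩ < σ ⟨i, by omega⟩ :=
      ⟨fun h => h.2, fun h => ⟨⟨by omega, hi⟩, h⟩⟩
    have hA : IsAscent σ (i + 1) ↔ ¬ σ ⟨i + 1, hi⟩ < σ ⟨i, by omega⟩ :=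
      ⟨fun h => not_lt_of_gt h.2, fun h => ⟨⟨by omega, hi⟩, lt_of_le_of_ne (not_lt.1 h) hne.symm⟩⟩
    simp only [hlt, hD, hA]
    split_ifs <;> push_cast <;> ring

theorem startsAtMin_wordOf {S : Finset ℕ} {n : ℕ} (hS : S.card = n) (σ : Equiv.Perm (Fin n)) :
    StartsAtMin (wordOf S hS σ) ↔ HasPositiveUpDown σ := by
  rw [StartsAtMin, length_wordOf]
  constructor
  · intro h j hj
    rcases j with _ | j
    · simp [ascentsBelow]
    · have := h j hj
      rw [height_wordOf hS σ hj] at this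
      omega
  · intro h i hi
    rw [height_wordOf hS σ hi]
    have := h (i + 1) hi
    omega

/-- Only the final height is left free. If negative, it is one unit step below a nonnegative height,
hence `-1`: the Dyck case. -/
theorem startsAtMin_take_wordOf {S : Finset ℕ} {n : ℕ} (hS : S.card = n + 1)
    (σ : Equiv.Perm (Fin (n + 1))) :
    StartsAtMin ((wordOf S hS σ).take n) ↔ HasPositiveUpDown σ ∨ HasDyckUpDown σ := by
  rw [← startsAtMin_wordOf hS, startsAtMin_take (by rw [length_wordOf]; omega), StartsAtMin,
    length_wordOf]
  constructor
  · intro h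
    by_cases h0 : 0 ≤ height (wordOf S hS σ) n
    · left
      intro i hi
      rcases Nat.lt_succ_iff_lt_or_eq.1 hi with hi | rfl
      exacts [h i hi, h0]
    · right
      constructor
      · rcases n with _ | n
        · exact absurd (height_zero _).ge h0
        · have h1 := h n (by omega)
          have h2 := height_wordOf hS σ (i := n + 1) (by omega)
          rw [height_succ] at h0 h2
          split_ifs at h0 h2 <;> omega
      · intro j hj
        rcases j with _ | j
        · simp [ascentsBelow]
        · have := h j (by omega)
          rw [height_wordOf hS σ (by omega)] at this
          omega
  · rintro (h | h) i hi
    · exact h i (by omega)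
    · rw [height_wordOf hS σ (by omega)]
      have := h.2 (i + 1) (by omega)
      omega

/-! ### Enumeration -/

section Counting
open Classical

/-- The number of permutations of size `n` with a positive up-down sequence. -/
noncomputable def positiveCount (n : ℕ) : ℕ := Nat.card {σ : Equiv.Perm (Fin n) // HasPositiveUpDown σ}

theorem card_startsAtMin (S : Finset ℕ) :
    ((words S).filter StartsAtMin).card = positiveCount S.card := by
  rw [card_filter_words rfl, positiveCount]
  simp_rw [startsAtMin_wordOf]

theorem card_endsAtMin (S : Finset ℕ) :
    ((words S).filter EndsAtMin).card = positiveCount S.card := by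
  rw [← card_startsAtMin]
  have hr : ∀ l, l.reverse ∈ words S ↔ l ∈ words S := fun l => by simp [mem_words]
  refine Finset.card_nbij' List.reverse List.reverse ?_ ?_ (fun l _ => l.reverse_reverse)
    (fun l _ => l.reverse_reverse)
  · intro l hl
    simp only [Finset.coe_filter, Set.mem_ofPred_eq] at hl ⊢
    exact ⟨(hr l).2 hl.1, (startsAtMin_reverse (mem_words.1 hl.1).1).2 hl.2⟩
  · intro l hl
    simp only [Finset.coe_filter, Set.mem_ofPred_eq] at hl ⊢
    have h := (hr l).2 hl.1
    refine ⟨h, (startsAtMin_reverse (mem_words.1 h).1).1 ?_⟩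
    rw [List.reverse_reverse]
    exact hl.2

/-- Double counting of pairs (word, good cut): by cut on the left, by word on the right. -/
theorem positiveCount_convolution (n : ℕ) (hn : 1 ≤ n) :
    ∑ k ∈ Finset.range (n + 1), n.choose k * (positiveCount k * positiveCount (n - k)) = 2 * n ! := by
  have h1 : ∀ k ∈ Finset.range (n + 1), n.choose k * (positiveCount k * positiveCount (n - k)) =
      ((words (Finset.range n)).filter fun l =>
        EndsAtMin (l.take k) ∧ StartsAtMin (l.drop k)).card := by
    intro k hk
    rw [card_words_split _ (by rw [Finset.card_range]; exact Finset.mem_range_succ_iff.1 hk)]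
    rw [Finset.sum_congr rfl (g := fun _ => positiveCount k * positiveCount (n - k)),
      Finset.sum_const, Finset.card_powersetCard, Finset.card_range, smul_eq_mul]
    intro T hT
    obtain ⟨hsub, rfl⟩ := Finset.mem_powersetCard.1 hT
    rw [card_endsAtMin, card_startsAtMin, Finset.card_sdiff_of_subset hsub, Finset.card_range]
  rw [Finset.sum_congr rfl h1]
  simp_rw [Finset.card_filter]
  rw [Finset.sum_comm, Finset.sum_congr rfl (g := fun _ => 2), Finset.sum_const, card_words,
    Finset.card_range, smul_eq_mul, mul_comm]
  intro l hl
  have hlen : l.length = n := by rw [length_of_mem_words hl, Finset.card_range]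
  rw [← Finset.card_filter, ← card_splits_eq_two hn (height l)]
  · congr 1
    ext k
    simp only [Finset.mem_filter, Finset.mem_range]
    refine and_congr_right fun hk => ?_
    rw [endsAtMin_take (by omega), startsAtMin_drop, hlen]
  · intro i _
    rw [height_succ]
    split_ifs <;> simp [sub_eq_add_neg]

theorem positiveCount_add_dyckCount (n : ℕ) :
    positiveCount (n + 1) + Nat.card {σ : Equiv.Perm (Fin (n + 1)) // HasDyckUpDown σ} =
      (n + 1) * positiveCount n := by
  have hS := Finset.card_range (n + 1)
  -- The conjunct `True` leaves the one-letter suffix unconstrained, in the shape `card_words_split`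
  -- expects.
  have h1 : ((words (Finset.range (n + 1))).filter fun l =>
      StartsAtMin (l.take n) ∧ True).card = (n + 1) * positiveCount n := by
    rw [card_words_split _ (Q := fun _ => True) (by simp)]
    rw [Finset.sum_congr rfl (g := fun _ => positiveCount n),
      Finset.sum_const, Finset.card_powersetCard, Finset.card_range, smul_eq_mul,
      Nat.choose_succ_self_right]
    intro T hT
    obtain ⟨hsub, rfl⟩ := Finset.mem_powersetCard.1 hT
    rw [card_startsAtMin, Finset.filter_true, card_words, Finset.card_sdiff_of_subset hsub,
      Finset.card_range, Nat.add_sub_cancel_left, Nat.factorial_one, mul_one]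
  rw [← h1, card_filter_words hS]
  simp_rw [and_true, startsAtMin_take_wordOf]
  rw [positiveCount, Nat.card_eq_fintype_card, Nat.card_eq_fintype_card, Nat.card_eq_fintype_card]
  refine (Fintype.card_subtype_or_disjoint _ _ ?_).symm
  rw [Pi.disjoint_iff]
  intro σ
  rw [Prop.disjoint_iff]
  by_contra! h
  have := h.1 _ le_rfl
  have := h.2.1
  omega

theorem positiveCount_zero : positiveCount 0 = 1 := by
  have h : ∀ σ : Equiv.Perm (Fin 0), HasPositiveUpDown σ := fun σ j hj => by
    simp [Nat.le_zero.1 hj, ascentsBelow]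
  rw [positiveCount, Nat.card_congr (Equiv.subtypeUnivEquiv h)]
  simp

theorem positiveCount_one : positiveCount 1 = 1 := by
  have := positiveCount_convolution 1 le_rfl
  simp [Finset.sum_range_succ, positiveCount_zero] at this
  omega

end Counting

theorem positiveCount_eq (m : ℕ) :
    positiveCount (2 * m) = (2 * m - 1)‼ ^ 2 ∧
      positiveCount (2 * m + 1) = (2 * m + 1)‼ * (2 * m - 1)‼ :=
  eq_doubleFactorial_of_recurrence _ positiveCount_zero positiveCount_one
    (recurrence_of_convolution _ positiveCount_zero positiveCount_convolution) m

end UpDown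

/-- Natural-number subtraction is used for `n - 1`, `n - 2`, `n - 3`. It is truncated only in
`(1 - 2)‼` and `(2 - 3)‼`, where `0‼ = 1` agrees with the usual convention `(-1)‼ = 1`. -/
theorem mainTheorem2 (n : ℕ) (hn : 1 ≤ n) :
    Nat.card {σ : Equiv.Perm (Fin n) // UpDown.HasPositiveUpDown σ} =
        (if Even n then (n - 1)‼ ^ 2 else n‼ * (n - 2)‼) ∧
      Nat.card {σ : Equiv.Perm (Fin n) // UpDown.HasDyckUpDown σ} =
        (if Even n then (n - 1)‼ * (n - 3)‼ else 0) := by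
  obtain ⟨n, rfl⟩ : ∃ k, n = k + 1 := ⟨n - 1, by omega⟩
  have hd := UpDown.positiveCount_add_dyckCount n
  change UpDown.positiveCount (n + 1) = _ ∧ _
  generalize Nat.card {σ : Equiv.Perm (Fin (n + 1)) // UpDown.HasDyckUpDown σ} = d at *
  rcases Nat.even_or_odd' n with ⟨m, rfl | rfl⟩
  · have ho : ¬ Even (2 * m + 1) := by simp
    obtain ⟨h1, h2⟩ := UpDown.positiveCount_eq m
    rw [if_neg ho, if_neg ho, h2, show 2 * m + 1 - 2 = 2 * m - 1 by omega]
    refine ⟨rfl, ?_⟩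
    -- Here `(2m+1) b(2m) = b(2m+1)`, which leaves `d = 0`.
    rw [h1, h2, Nat.doubleFactorial_add_one] at hd
    nlinarith
  · have he : Even (2 * m + 1 + 1) := ⟨m + 1, by ring⟩
    have h1 := (UpDown.positiveCount_eq (m + 1)).1
    have h2 := (UpDown.positiveCount_eq m).2
    rw [show 2 * (m + 1) = 2 * m + 1 + 1 by ring] at h1
    rw [if_pos he, if_pos he, h1, show 2 * m + 1 + 1 - 3 = 2 * m - 1 by omega]
    refine ⟨rfl, ?_⟩
    -- With `(2m+1)‼ = (2m+1)(2m-1)‼`, the difference `(2m+2)(2m+1)‼(2m-1)‼ - (2m+1)‼²` is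
    -- `(2m+1)‼(2m-1)‼`.
    rw [h1, h2, Nat.add_sub_cancel, Nat.doubleFactorial_add_one] at hd
    rw [Nat.add_sub_cancel, Nat.doubleFactorial_add_one]
    simp only [Nat.add_sub_cancel] at *
    nlinarith
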